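/- Let $\mathbb{K}$ be an algebraically closed field of characteristic $0$, let $n\ge 2$, and let $1\le j_1,\dots,j_{n-1}\le n$. For $i\ge 0$ let $HD^i_{n-1}$ be the $\mathbb{K}$-linear endomorphism of $\mathbb{K}[x_1,\dots,x_{n-1}]$ with $$HD^i_{n-1}\big(x_1^{\alpha_1}\cdots x_{n-1}^{\alpha_{n-1}}\big)=\sum_{k_1+\dots+k_{n-1}=i}\binom{\alpha_1}{k_1}\cdots\binom{\alpha_{n-1}}{k_{n-1}}\,x_1^{\alpha_1-k_1}\cdots x_{n-1}^{\alpha_{n-1}-k_{n-1}},$$ and put $\mathbf{x}_{n-1}=x_1x_2\cdots x_{n-1}$. For $1\le j\le n-1$ let $\Phi^{\#}[T]_j:\mathbb{K}[x_1,\dots,x_{n-1}]\to\mathbb{K}[x_1,\dots,x_{n-1},T]$ be the $\mathbb{K}$-algebra homomorphism with $x_j\mapsto(1-2T)x_j$ and $x_l\mapsto x_l-Tx_j$ for $l\ne j$; let $\Phi^{\#}[T]_n$ be the natural inclusion. Let $$Y(j_1,\dots,j_{n-1})=\operatorname{Spec}\frac{\mathbb{K}[x_1,\dots,x_{n-1},T]}{\big(\Phi^{\#}[T]_{j_i}(HD^{i-1}_{n-1}\mathbf{x}_{n-1})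 : 1\le i\le n-1\big)},$$ and let $\varphi^{\star}:Y(j_1,\dots,j_{n-1})\to\mathbb{A}^1_{\mathbb{K}}=\operatorname{Spec}\mathbb{K}[T]$ be the morphism induced by sending $T$ to its class. For $\alpha\in\mathbb{K}$ let $(\varphi^{\star})^{-1}(\alpha)=Y(j_1,\dots,j_{n-1})\times_{\mathbb{A}^1_{\mathbb{K}}}\operatorname{Spec}\mathbb{K}[T]/(T-\alpha)$ be the fiber over $\alpha$; call it singular if its dimension is positive, and non-singular otherwise. Then: 1. For every $\alpha\in\mathbb{Q}\setminus\{\tfrac1m : m\in\mathbb{Z}\setminus\{0\}\}$, the fiber $(\varphi^{\star})^{-1}(\alpha)$ is non-singular. 2. For every integer $m$ with $|m|\ge 2$ there is a finite set of primes $\mathcal{P}(m)$ such that, for every prime $p\notin\mathcal{P}(m)$, the fiber $(\varphi^{\star})^{-1}\big(\tfrac{1}{m^{p-2}}\big)$ is non-singular. -/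

import Mathlib

noncomputable section

open AlgebraicGeometry CategoryTheory CategoryTheory.Limits

universe u

namespace CasasAlvero

/-- The multivariate Hasse-Schmidt derivation `HD^i_k` on `K[x_1, …, x_k]`: the `K`-linear map with
`x^α ↦ ∑ (α_1 choose j_1) ⋯ (α_k choose j_k) x^(α - j)`, the sum being over all
`j = (j_1, …, j_k)` with `j_1 + ⋯ + j_k = i`.  (If some `j_l > α_l`, so that the subtraction of
exponents truncates, then the coefficient is zero.) -/
def HD (K : Type u) [CommRing K] (k i : ℕ) :
    MvPolynomial (Fin k) K →ₗ[K] MvPolynomial (Fin k) K :=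
  (MvPolynomial.basisMonomials (Fin k) K).constr K fun α =>
    ∑ j ∈ Finset.univ.finsuppAntidiag i,
      MvPolynomial.monomial (α - j) (∏ l, ((α l).choose (j l) : K))

/-- The ring `K[x_1, …, x_N, T]`, as the polynomial ring in `x_1, …, x_N` over `K[T]`. -/
abbrev PolyT (K : Type u) [CommRing K] (N : ℕ) : Type u :=
  MvPolynomial (Fin N) (Polynomial K)

/-- The variable `T` of `K[x_1, …, x_N, T]`. -/
def T (K : Type u) [CommRing K] (N : ℕ) : PolyT K N := MvPolynomial.C Polynomial.X

/-- The `K`-algebra map `Φ^#[T]_j : K[x_1, …, x_{n-1}] → K[x_1, …, x_{n-1}, T]` for `1 ≤ j ≤ n`.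
For `j ≤ n - 1` it sends `x_j` to `(1 - 2T) x_j` and `x_l` to `x_l - T x_j` for `l ≠ j`; for
`j = n` it is the inclusion.  Indices are shifted by one: `j : Fin n` stands for `j + 1`. -/
def Phi (K : Type u) [CommRing K] (n : ℕ) (j : Fin n) :
    MvPolynomial (Fin (n - 1)) K →ₐ[K] PolyT K (n - 1) :=
  MvPolynomial.aeval fun l : Fin (n - 1) =>
    if h : (j : ℕ) < n - 1 then
      if l = ⟨j, h⟩ then (1 - 2 * T K (n - 1)) * MvPolynomial.X ⟨j, h⟩
      else MvPolynomial.X l - T K (n - 1) * MvPolynomial.X ⟨j, h⟩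
    else MvPolynomial.X l

/-- The ideal generated by `Φ^#[T]_{j_i} (HD^{i-1}_{n-1} (x_1 ⋯ x_{n-1}))` for `1 ≤ i ≤ n - 1`
(below, `i : Fin (n - 1)` stands for `i + 1`). -/
def idealY (K : Type u) [CommRing K] (n : ℕ) (j : Fin (n - 1) → Fin n) :
    Ideal (PolyT K (n - 1)) :=
  Ideal.span (Set.range fun i : Fin (n - 1) =>
    Phi K n (j i) (HD K (n - 1) i (∏ l : Fin (n - 1), MvPolynomial.X l)))

/-- The ring `𝒪(j_1, …, j_{n-1})`. -/
def coordRing (K : Type u) [CommRing K] (n : ℕ) (j : Fin (n - 1) → Fin n) : Type u :=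
  PolyT K (n - 1) ⧸ idealY K n j

instance (K : Type u) [CommRing K] (n : ℕ) (j : Fin (n - 1) → Fin n) :
    CommRing (coordRing K n j) :=
  Ideal.Quotient.commRing (idealY K n j)

/-- The map `φ : K[T] → 𝒪(j_1, …, j_{n-1})`, sending `T` to its class. -/
def phi (K : Type u) [CommRing K] (n : ℕ) (j : Fin (n - 1) → Fin n) :
    Polynomial K →+* coordRing K n j :=
  (Ideal.Quotient.mk (idealY K n j)).comp MvPolynomial.C

/-- The affine line `𝔸¹_K = Spec K[T]`. -/
abbrev A1 (K : Type u) [CommRing K] : Scheme.{u} := Spec (.of (Polynomial K))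

/-- The affine scheme `Y(j_1, …, j_{n-1}) = Spec 𝒪(j_1, …, j_{n-1})`. -/
abbrev Y (K : Type u) [CommRing K] (n : ℕ) (j : Fin (n - 1) → Fin n) : Scheme.{u} :=
  Spec (.of (coordRing K n j))

/-- The family `φ^* : Y(j_1, …, j_{n-1}) ⟶ 𝔸¹_K`. -/
def phiStar (K : Type u) [CommRing K] (n : ℕ) (j : Fin (n - 1) → Fin n) : Y K n j ⟶ A1 K :=
  Spec.map (CommRingCat.ofHom (phi K n j))

/-- The closed immersion `Spec (K[T] / (T - α)) ⟶ 𝔸¹_K` of the point `α`. -/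
def point (K : Type u) [CommRing K] (α : K) :
    Spec (.of (Polynomial K ⧸ Ideal.span {Polynomial.X - Polynomial.C α})) ⟶ A1 K :=
  Spec.map (CommRingCat.ofHom (Ideal.Quotient.mk _))

/-- The scheme-theoretic fiber `(φ^*)⁻¹(α) = Y(j_1, …, j_{n-1}) ×_{𝔸¹} Spec (K[T] / (T - α))`. -/
def fiber (K : Type u) [CommRing K] (n : ℕ) (j : Fin (n - 1) → Fin n) (α : K) : Scheme.{u} :=
  pullback (phiStar K n j) (point K α)

/-- A fiber of `φ^*` is singular if it is positive-dimensional. -/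
def IsSingularFiber (K : Type u) [CommRing K] (n : ℕ) (j : Fin (n - 1) → Fin n) (α : K) : Prop :=
  0 < topologicalKrullDim (fiber K n j α)

end CasasAlvero

end

namespace CasasAlvero

open Finset AlgebraicGeometry CategoryTheory CategoryTheory.Limits

/-! Since `HD` applied `i` times to a product of N variables gives the elementary symmetric function
of degree N - i, the fiber over t is cut out by homogeneous equations. If over every extension field
their only zero is the origin, the fiber has at most one point (`not_isSingularFiber`). At t = 0
this holds: all elementary symmetric functions vanish. For rational t whose numerator is not ±1,
some prime p divides the numerator. A nonzero solution can be scaled and reduced at a valuation over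
p, giving a nonzero solution at t = 0, a contradiction (`IsSolution.eq_zero_of_rat`). For the second
claim, 1/m^(p-2) reduces to m mod p by Fermat. The integer m is covered by the first claim, and
clearing denominators there shows that the fiber over m stays trivial modulo all but finitely many
p. -/

/-- The values at `x` of the images of the variables under `Φ^#[t]_j`. -/
def shift {A : Type*} [CommRing A] (n : ℕ) (j : Fin n) (t : A) (x : Fin (n - 1) → A) :
    Fin (n - 1) → A := fun l =>
  if h : (j : ℕ) < n - 1 then
    if l = ⟨j, h⟩ then (1 - 2 * t) * x ⟨j, h⟩ else x l - t * x ⟨j, h⟩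
  else x l

/-- The `k`-th elementary symmetric function of a finite family of ring elements. -/
def elemSymm {A : Type*} [CommRing A] {N : ℕ} (k : ℕ) (x : Fin N → A) : A :=
  ∑ s ∈ powersetCard k univ, ∏ l ∈ s, x l

/-- `x` is a common zero of the equations which define the fiber over `t`. -/
def IsSolution {A : Type*} [CommRing A] (n : ℕ) (j : Fin (n - 1) → Fin n) (t : A)
    (x : Fin (n - 1) → A) : Prop :=
  ∀ i : Fin (n - 1), elemSymm (n - 1 - i) (shift n (j i) t x) = 0

/-! ### Functoriality and homogeneity of the equations; the case t = 0 -/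

section Basic

variable {A B : Type*} [CommRing A] [CommRing B]

lemma map_shift (f : A →+* B) (n : ℕ) (j : Fin n) (t : A) (x : Fin (n - 1) → A) (l) :
    f (shift n j t x l) = shift n j (f t) (fun i => f (x i)) l := by
  unfold shift
  split_ifs <;> simp [map_ofNat]

lemma map_elemSymm (f : A →+* B) {N : ℕ} (k : ℕ) (x : Fin N → A) :
    f (elemSymm k x) = elemSymm k (fun i => f (x i)) := by
  simp [elemSymm]

lemma map_elemSymm_shift (f : A →+* B) (n k : ℕ) (j : Fin n) (t : A) (x : Fin (n - 1) → A) :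
    f (elemSymm k (shift n j t x)) = elemSymm k (shift n j (f t) (fun i => f (x i))) := by
  rw [map_elemSymm]
  congr 1
  funext l
  exact map_shift f n j t x l

lemma IsSolution.map (f : A →+* B) {n : ℕ} {j : Fin (n - 1) → Fin n} {t : A}
    {x : Fin (n - 1) → A} (h : IsSolution n j t x) :
    IsSolution n j (f t) (fun i => f (x i)) := fun i => by
  rw [← map_elemSymm_shift, h i, map_zero]

lemma IsSolution.of_map {f : A →+* B} (hf : Function.Injective f) {n : ℕ}
    {j : Fin (n - 1) → Fin n} {t : A} {x : Fin (n - 1) → A}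
    (h : IsSolution n j (f t) (fun i => f (x i))) : IsSolution n j t x := fun i => by
  apply hf
  rw [map_elemSymm_shift, h i, map_zero]

lemma shift_smul (n : ℕ) (j : Fin n) (t c : A) (x : Fin (n - 1) → A) :
    shift n j t (fun i => c * x i) = fun i => c * shift n j t x i := by
  funext l
  unfold shift
  split_ifs <;> ring

lemma elemSymm_smul {N : ℕ} (k : ℕ) (c : A) (x : Fin N → A) :
    elemSymm k (fun i => c * x i) = c ^ k * elemSymm k x := by
  unfold elemSymm
  rw [mul_sum]
  refine sum_congr rfl fun s hs => ?_
  rw [prod_mul_distrib, prod_const, (mem_powersetCard.1 hs).2]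

lemma IsSolution.smul {n : ℕ} {j : Fin (n - 1) → Fin n} {t : A} {x : Fin (n - 1) → A}
    (h : IsSolution n j t x) (c : A) : IsSolution n j t (fun i => c * x i) := fun i => by
  rw [shift_smul, elemSymm_smul, h i, mul_zero]

lemma shift_zero (n : ℕ) (j : Fin n) (x : Fin (n - 1) → A) : shift n j 0 x = x := by
  funext l
  unfold shift
  split_ifs with h1 h2
  · subst h2; simp
  · simp
  · rfl

/-- By Vieta, ∏ (X + x_i) = X^N; evaluating at -x_l gives (-x_l)^N = 0. -/
lemma eq_zero_of_elemSymm_eq_zero [IsDomain A] {N : ℕ} {x : Fin N → A}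
    (h : ∀ i : Fin N, elemSymm (N - i) x = 0) : x = 0 := by
  funext l
  have hprod : (((univ : Finset (Fin N)).val.map x).map
      fun r => Polynomial.X + Polynomial.C r).prod = Polynomial.X ^ N := by
    rw [Multiset.prod_X_add_C_eq_sum_esymm, Multiset.card_map, card_val, card_fin,
      sum_range_succ', sum_eq_zero]
    · rw [Finset.esymm_map_val]; simp
    · intro k hk
      have hk : k < N := mem_range.1 hk
      have := h ⟨N - (k + 1), by omega⟩
      have hsub : N - (N - (k + 1)) = k + 1 := by omega
      rw [elemSymm, hsub] at this
      rw [Finset.esymm_map_val, this, map_zero, zero_mul]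
  have heval := congrArg (Polynomial.eval (-x l)) hprod
  rw [Multiset.map_map, Polynomial.eval_pow, Polynomial.eval_X] at heval
  change Polynomial.eval (-x l) (∏ i, (Polynomial.X + Polynomial.C (x i))) = _ at heval
  rw [Polynomial.eval_prod, prod_eq_zero (mem_univ l) (by simp)] at heval
  exact neg_eq_zero.1 (eq_zero_of_pow_eq_zero heval.symm)

lemma IsSolution.eq_zero_of_param_zero [IsDomain A] {n : ℕ} {j : Fin (n - 1) → Fin n}
    {x : Fin (n - 1) → A} (h : IsSolution n j 0 x) : x = 0 :=
  eq_zero_of_elemSymm_eq_zero fun i => by simpa only [shift_zero] using h i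

end Basic

/-! ### Reduction of solutions modulo p -/

section Reduction

variable {L : Type*} [Field L]

/-- The prime p is not a unit in the copy of ℤ inside `L`, so some valuation ring of `L` has p in
its maximal ideal. `L` need not be algebraic over ℚ. -/
lemma exists_valuationSubring_residue_eq_zero [CharZero L] {p : ℕ} (hp : p.Prime) :
    ∃ V : ValuationSubring L, (p : IsLocalRing.ResidueField V) = 0 := by
  let A := (Int.castRingHom L).range
  have hI : Ideal.span {(p : A)} ≠ ⊤ := by
    rw [Ne, Ideal.span_singleton_eq_top]
    intro hu
    obtain ⟨⟨_, b, rfl⟩, hb⟩ := hu.exists_right_inv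
    have h1 : ((p : ℤ) * b : L) = 1 := by simpa using congrArg A.subtype hb
    have h2 : (p : ℤ) * b = 1 := by exact_mod_cast h1
    have h3 : (p : ℤ) ∣ 1 := ⟨b, h2.symm⟩
    exact hp.one_lt.ne' (by exact_mod_cast Int.eq_one_of_dvd_one (by positivity) h3)
  obtain ⟨V, -, hV⟩ := Ideal.image_subset_nonunits_valuationSubring _ hI
  refine ⟨V, ?_⟩
  have h := hV ⟨_, Ideal.mem_span_singleton_self _, rfl⟩
  rw [← V.image_maximalIdeal] at h
  obtain ⟨v, hv, hvp⟩ := h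
  have : v = (p : V) := Subtype.ext (by simpa using hvp)
  rw [← map_natCast (IsLocalRing.residue V), IsLocalRing.residue_eq_zero_iff, ← this]
  exact hv

/-- A nonzero solution over a valued field specialises to a nonzero one over the residue field. -/
lemma IsSolution.exists_residue (V : ValuationSubring L) {n : ℕ} {j : Fin (n - 1) → Fin n}
    {t : V} {x : Fin (n - 1) → L} (h : IsSolution n j (t : L) x) (hx : x ≠ 0) :
    ∃ y : Fin (n - 1) → IsLocalRing.ResidueField V,
      IsSolution n j (IsLocalRing.residue V t) y ∧ y ≠ 0 := by
  obtain ⟨l0, hl0⟩ := Function.ne_iff.1 hx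
  -- Dividing by a coordinate of largest valuation makes all coordinates integral and this one equal
  -- to 1, so the reduction is nonzero.
  obtain ⟨l, -, hl⟩ := exists_max_image univ (fun i => V.valuation (x i)) ⟨l0, mem_univ _⟩
  have hxl : x l ≠ 0 := by
    intro h0
    have := hl l0 (mem_univ _)
    simp only [h0, map_zero, le_zero_iff, map_eq_zero] at this
    exact hl0 this
  have hmem : ∀ i, (x l)⁻¹ * x i ∈ V := fun i => by
    rw [← V.valuation_le_one_iff, map_mul, map_inv₀]
    have hv : V.valuation (x l) ≠ 0 := by simpa using hxl
    exact inv_mul_le_one_of_le₀ (hl i (mem_univ _)) zero_le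
  have hs : IsSolution n j t (fun i => (⟨_, hmem i⟩ : V)) :=
    IsSolution.of_map (f := V.subtype) Subtype.val_injective (h.smul (x l)⁻¹)
  refine ⟨_, hs.map (IsLocalRing.residue V), Function.ne_iff.2 ⟨l, ?_⟩⟩
  have : (⟨_, hmem l⟩ : V) = 1 := Subtype.ext (inv_mul_cancel₀ hxl)
  simp [this]

/-- If `t * b = a` with `b` prime to `p`, then `t` is integral at `p`, and `t * b = a` in the
residue field. -/
lemma exists_residue_mul_eq (V : ValuationSubring L) {p : ℕ}
    (hV : (p : IsLocalRing.ResidueField V) = 0) {a b : ℤ} (hb : IsCoprime b p) {t : L}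
    (ht : t * b = a) :
    ∃ s : V, (s : L) = t ∧ (b : IsLocalRing.ResidueField V) ≠ 0 ∧
      IsLocalRing.residue V s * b = a := by
  have hb0 : (b : IsLocalRing.ResidueField V) ≠ 0 := by
    intro h0
    obtain ⟨u, v, huv⟩ := hb
    have := congrArg (Int.cast : ℤ → IsLocalRing.ResidueField V) huv
    simp [h0, hV] at this
  have hu : IsUnit (b : V) := by
    rw [← IsLocalRing.residue_ne_zero_iff_isUnit, map_intCast]
    exact hb0
  obtain ⟨c, hc⟩ := hu.exists_right_inv
  have hcL : (b : L) * c = 1 := by simpa using congrArg V.subtype hc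
  refine ⟨a * c, ?_, hb0, ?_⟩
  · simp only [MulMemClass.coe_mul, SubringClass.coe_intCast]
    rw [← ht, mul_assoc, hcL, mul_one]
  · rw [map_mul, map_intCast, mul_assoc, mul_comm _ (b : IsLocalRing.ResidueField V),
      ← map_intCast (IsLocalRing.residue V) b, ← map_mul, hc, map_one, mul_one]

lemma IsSolution.eq_zero_of_rat [CharZero L] {n : ℕ} {j : Fin (n - 1) → Fin n} {q : ℚ}
    (hq : q.num.natAbs ≠ 1) {x : Fin (n - 1) → L} (h : IsSolution n j (q : L) x) : x = 0 := by
  by_contra hx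
  -- This includes q = 0, where any prime divides the numerator.
  obtain ⟨p, hp, hpq⟩ := Nat.exists_prime_and_dvd hq
  obtain ⟨V, hV⟩ := exists_valuationSubring_residue_eq_zero (L := L) hp
  have hcop : IsCoprime (q.den : ℤ) p :=
    (Nat.isCoprime_iff_coprime.2 (q.reduced.coprime_dvd_left hpq)).symm
  have hmul : (q : L) * ((q.den : ℤ) : L) = (q.num : L) := by
    exact_mod_cast congrArg (Rat.cast : ℚ → L) q.mul_den_eq_num
  obtain ⟨s, hs, hb, hab⟩ := exists_residue_mul_eq V hV hcop hmul
  obtain ⟨c, hc⟩ := Int.natCast_dvd.2 hpq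
  have hs0 : IsLocalRing.residue V s = 0 := by
    have : (q.num : IsLocalRing.ResidueField V) = 0 := by rw [hc]; simp [hV]
    rw [this] at hab
    exact (mul_eq_zero.1 hab).resolve_right hb
  rw [← hs] at h
  obtain ⟨y, hy, hy0⟩ := h.exists_residue V hx
  rw [hs0] at hy
  exact hy0 hy.eq_zero_of_param_zero

end Reduction

/-! ### Integral equations and exclusion of finitely many primes -/

section Integral

/-- The ideal of the fiber over the integer `m`, with integral coefficients. -/
noncomputable def integralIdeal (n : ℕ) (j : Fin (n - 1) → Fin n) (m : ℤ) :
    Ideal (MvPolynomial (Fin (n - 1)) ℤ) :=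
  Ideal.span (Set.range fun i : Fin (n - 1) =>
    elemSymm (n - 1 - i) (shift n (j i) (m : MvPolynomial (Fin (n - 1)) ℤ) MvPolynomial.X))

/-- Otherwise a prime containing the ideal avoids every D * X_l^N with D ≠ 0. Its residue field then
has characteristic 0 and carries a solution over m with nonzero l-th coordinate. -/
lemma exists_mul_X_pow_mem_integralIdeal (n : ℕ) (j : Fin (n - 1) → Fin n) {m : ℤ}
    (hm : m.natAbs ≠ 1) (l : Fin (n - 1)) :
    ∃ (D : ℤ) (N : ℕ), D ≠ 0 ∧
      MvPolynomial.C D * MvPolynomial.X l ^ N ∈ integralIdeal n j m := by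
  by_contra! hcon
  let S : Submonoid (MvPolynomial (Fin (n - 1)) ℤ) :=
    { carrier := {f | ∃ (D : ℤ) (N : ℕ), D ≠ 0 ∧ f = MvPolynomial.C D * MvPolynomial.X l ^ N}
      one_mem' := ⟨1, 0, one_ne_zero, by simp⟩
      mul_mem' := by
        rintro _ _ ⟨D, N, hD, rfl⟩ ⟨D', N', hD', rfl⟩
        exact ⟨D * D', N + N', mul_ne_zero hD hD', by rw [map_mul, pow_add]; ring⟩ }
  have hdisj : Disjoint (integralIdeal n j m : Set (MvPolynomial (Fin (n - 1)) ℤ)) S := by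
    rw [Set.disjoint_left]
    rintro _ hf ⟨D, N, hD, rfl⟩
    exact hcon D N hD hf
  obtain ⟨P, hP, hIP, hPS⟩ := Ideal.exists_le_prime_disjoint _ S hdisj
  let L := FractionRing (MvPolynomial (Fin (n - 1)) ℤ ⧸ P)
  let f : MvPolynomial (Fin (n - 1)) ℤ →+* L :=
    (algebraMap (MvPolynomial (Fin (n - 1)) ℤ ⧸ P) L).comp (Ideal.Quotient.mk P)
  have hf : ∀ a, f a = 0 → a ∈ P := fun a ha => by
    rw [← Ideal.Quotient.eq_zero_iff_mem]
    exact IsFractionRing.injective (MvPolynomial (Fin (n - 1)) ℤ ⧸ P) L (by simpa [f] using ha)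
  have hmem : ∀ a ∈ P, f a = 0 := fun a ha => by
    simp [f, Ideal.Quotient.eq_zero_iff_mem.2 ha]
  have : CharZero L := charZero_of_injective_algebraMap (R := ℤ) <| by
    rw [injective_iff_map_eq_zero]
    intro D hD
    by_contra hD0
    refine Set.disjoint_left.1 hPS (hf (MvPolynomial.C D) ?_) ⟨D, 0, hD0, by simp⟩
    rw [← hD]
    simp
  have hsol : IsSolution n j ((m : ℚ) : L) (fun i => f (MvPolynomial.X i)) := fun i => by
    have := hmem _ (hIP (Ideal.subset_span ⟨i, rfl⟩))
    rw [map_elemSymm_shift, map_intCast] at this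
    simpa using this
  have h0 := congrFun (hsol.eq_zero_of_rat (by simpa using hm)) l
  exact Set.disjoint_left.1 hPS (hf _ h0) ⟨1, 1, one_ne_zero, by simp⟩

lemma exists_finset_primes_forall_eq_zero (n : ℕ) (j : Fin (n - 1) → Fin n) {m : ℤ}
    (hm : 2 ≤ |m|) :
    ∃ P : Finset ℕ, (∀ p ∈ P, p.Prime) ∧ ∀ p : ℕ, p.Prime → p ∉ P →
      ∀ {L : Type*} [Field L] [CharZero L] (x : Fin (n - 1) → L),
        IsSolution n j ((1 / (m : ℚ) ^ (p - 2) : ℚ) : L) x → x = 0 := by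
  have hm1 : m.natAbs ≠ 1 := by
    intro h
    rw [Int.abs_eq_natAbs, h] at hm
    norm_num at hm
  have hm0 : m ≠ 0 := by rintro rfl; simp at hm
  choose D N hD hDN using fun l => exists_mul_X_pow_mem_integralIdeal n j hm1 l
  refine ⟨(2 * m.natAbs * ∏ l, (D l).natAbs).primeFactors,
    fun p hp => Nat.prime_of_mem_primeFactors hp, fun p hp hpP L _ _ x hx => ?_⟩
  have hne : 2 * m.natAbs * ∏ l, (D l).natAbs ≠ 0 := by
    simp [hm0, prod_eq_zero_iff, hD]
  have hdvd : ¬ p ∣ 2 * m.natAbs * ∏ l, (D l).natAbs := fun h =>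
    hpP (Nat.mem_primeFactors.2 ⟨hp, h, hne⟩)
  have hp2 : p ≠ 2 := fun h => by
    subst h
    exact hdvd ((dvd_mul_right 2 _).mul_right _)
  have hpm : ¬ (p : ℤ) ∣ m := fun h =>
    hdvd (((Int.natCast_dvd.1 h).mul_left 2).mul_right _)
  have hpD : ∀ l, ¬ (p : ℤ) ∣ D l := fun l h =>
    hdvd (((Int.natCast_dvd.1 h).trans (dvd_prod_of_mem (fun i => (D i).natAbs) (mem_univ l))).mul_left _)
  have hcop : ∀ a : ℤ, ¬ (p : ℤ) ∣ a → IsCoprime a p := fun a ha =>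
    ((Nat.prime_iff_prime_int.1 hp).coprime_iff_not_dvd.2 ha).symm
  by_contra hx0
  obtain ⟨V, hV⟩ := exists_valuationSubring_residue_eq_zero (L := L) hp
  have hmL : (m : L) ≠ 0 := by exact_mod_cast hm0
  obtain ⟨s, hs, hb, hab⟩ := exists_residue_mul_eq V hV (a := 1) (b := m ^ (p - 2))
    (hcop _ hpm).pow_left (t := ((1 / (m : ℚ) ^ (p - 2) : ℚ) : L)) (by push_cast; field_simp)
  -- Fermat: m * m^(p-2) = 1 mod p, so the parameter 1/m^(p-2) has residue m.
  have hfermat : (m : IsLocalRing.ResidueField V) * ((m ^ (p - 2) : ℤ) : IsLocalRing.ResidueField V)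
      = (1 : ℤ) := by
    have h1 : m ^ (p - 1) ≡ 1 [ZMOD p] := Int.ModEq.pow_card_sub_one_eq_one hp (hcop _ hpm)
    obtain ⟨c, hc⟩ := h1.dvd
    have hpp : p - 1 = p - 2 + 1 := by have := hp.two_le; omega
    rw [hpp, pow_succ] at hc
    have h2 : m * m ^ (p - 2) = 1 - p * c := by rw [← hc]; ring
    have := congrArg (Int.cast : ℤ → IsLocalRing.ResidueField V) h2
    rw [Int.cast_mul] at this
    rw [this]
    simp [hV]
  have hsm : IsLocalRing.residue V s = m := mul_right_cancel₀ hb (hab.trans hfermat.symm)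
  rw [← hs] at hx
  obtain ⟨y, hy, hy0⟩ := hx.exists_residue V hx0
  rw [hsm] at hy
  refine hy0 (funext fun l => ?_)
  let f : MvPolynomial (Fin (n - 1)) ℤ →+* IsLocalRing.ResidueField V :=
    MvPolynomial.eval₂Hom (Int.castRingHom _) y
  have hker : integralIdeal n j m ≤ RingHom.ker f := by
    rw [integralIdeal, Ideal.span_le]
    rintro _ ⟨i, rfl⟩
    rw [SetLike.mem_coe, RingHom.mem_ker, map_elemSymm_shift, map_intCast]
    simpa [f] using hy i
  have h0 := hker (hDN l)
  rw [RingHom.mem_ker] at h0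
  have hDl : (D l : IsLocalRing.ResidueField V) ≠ 0 := by
    obtain ⟨s, -, hb, -⟩ := exists_residue_mul_eq V hV (a := 0) (hcop _ (hpD l)) (t := (0 : L))
      (by simp)
    exact hb
  have h1 : (D l : IsLocalRing.ResidueField V) * y l ^ N l = 0 := by
    have hC : f (MvPolynomial.C (D l)) = D l := MvPolynomial.eval₂_C _ _ _
    have hX : f (MvPolynomial.X l) = y l := MvPolynomial.eval₂_X _ _ _
    rwa [map_mul, map_pow, hC, hX] at h0
  exact eq_zero_of_pow_eq_zero ((mul_eq_zero.1 h1).resolve_left hDl)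

end Integral

/-! ### From solutions to the dimension of the scheme-theoretic fiber -/

section Fiber

variable {K : Type u} [Field K]

lemma HD_prod_X {R : Type u} [CommRing R] (N i : ℕ) (hi : i ≤ N) :
    HD R N i (∏ l, MvPolynomial.X l) = elemSymm (N - i) MvPolynomial.X := by
  classical
  let u : Fin N →₀ ℕ := Finsupp.equivFunOnFinite.symm fun _ => 1
  have hu : (∏ l, MvPolynomial.X l : MvPolynomial (Fin N) R) =
      MvPolynomial.basisMonomials (Fin N) R u := by
    rw [MvPolynomial.coe_basisMonomials]
    change _ = MvPolynomial.monomial u 1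
    rw [MvPolynomial.monomial_eq, map_one, one_mul,
      Finsupp.prod_fintype _ _ (by simp)]
    simp [u]
  rw [hu, HD, Module.Basis.constr_basis, elemSymm]
  symm
  have hcard : ∀ s : Finset (Fin N), ∑ l, (if l ∈ s then 0 else 1) = N - #s := fun s => by
    have : ∀ l, (if l ∈ s then 0 else 1) = if l ∈ sᶜ then 1 else 0 := fun l => by
      by_cases hl : l ∈ s <;> simp [hl]
    rw [sum_congr rfl fun l _ => this l, sum_ite_mem, univ_inter, ← card_eq_sum_ones,
      card_compl, Fintype.card_fin]
  -- `e s` differentiates once in each variable outside `s`, leaving ∏_{l ∈ s} x_l. A multi-index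
  -- with an entry above 1 has coefficient 0.
  let e : Finset (Fin N) → Fin N →₀ ℕ := fun s =>
    Finsupp.equivFunOnFinite.symm fun l => if l ∈ s then 0 else 1
  have he : ∀ s l, e s l = if l ∈ s then 0 else 1 := fun _ _ => rfl
  refine sum_of_injOn e ?_ ?_ ?_ ?_
  · intro s _ t _ hst
    ext l
    have := DFunLike.congr_fun hst l
    rw [he, he] at this
    by_cases hs : l ∈ s <;> by_cases ht : l ∈ t <;> simp_all
  · intro s hs
    rw [mem_coe, mem_powersetCard] at hs
    rw [mem_coe, mem_finsuppAntidiag]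
    refine ⟨?_, subset_univ _⟩
    rw [sum_congr rfl fun l _ => he s l, hcard, hs.2]
    omega
  · intro a ha hae
    rw [mem_finsuppAntidiag] at ha
    by_cases hle : ∀ l, a l ≤ 1
    · have hea : e {l | a l = 0} = a := by
        ext l
        rw [he]
        have := hle l
        by_cases h0 : a l = 0
        · simp [h0]
        · simp only [mem_filter, mem_univ, true_and, h0, if_false]; omega
      refine absurd ⟨_, ?_, hea⟩ hae
      have h1 := hcard {l | a l = 0}
      rw [← sum_congr rfl fun l _ => he _ l, hea, ha.1] at h1
      have h2 := card_le_univ (univ.filter fun l => a l = 0)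
      rw [Fintype.card_fin] at h2
      rw [mem_coe, mem_powersetCard]
      exact ⟨subset_univ _, by omega⟩
    · push Not at hle
      obtain ⟨l, hl⟩ := hle
      rw [prod_eq_zero (mem_univ l), map_zero]
      simp [u, Nat.choose_eq_zero_of_lt hl]
  · intro s _
    have hone : ∏ l, (((u l).choose (e s l) : ℕ) : R) = 1 :=
      prod_eq_one fun l _ => by
        rw [he]
        by_cases hl : l ∈ s <;> simp [u, hl]
    rw [hone, MvPolynomial.monomial_eq, map_one, one_mul, Finsupp.prod_fintype _ _ (by simp),
      ← prod_subset (subset_univ s)]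
    · refine prod_congr rfl fun l hl => ?_
      simp [u, he, hl]
    · intro l _ hl
      simp [u, he, hl]

lemma Phi_HD_prod_X (n : ℕ) (j : Fin n) (i : Fin (n - 1)) :
    Phi K n j (HD K (n - 1) i (∏ l : Fin (n - 1), MvPolynomial.X l)) =
      elemSymm (n - 1 - i) (shift n j (T K (n - 1)) MvPolynomial.X) := by
  rw [HD_prod_X _ _ i.2.le]
  change (Phi K n j : _ →ₐ[K] _).toRingHom _ = _
  rw [map_elemSymm]
  congr 1
  funext l
  simp [Phi, shift, T]

/-- Such an `f` factors through evaluation at x = 0, T = α, followed by an injective map `K → L`. -/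
lemma ker_eq_of_map_X_eq_zero {N : ℕ} {L : Type*} [Field L] {α : K}
    (f : PolyT K N →+* L) (hX : ∀ l, f (MvPolynomial.X l) = 0)
    (hT : f (T K N - MvPolynomial.C (Polynomial.C α)) = 0) :
    RingHom.ker f = RingHom.ker
      ((Polynomial.evalRingHom α).comp (MvPolynomial.constantCoeff : PolyT K N →+* _)) := by
  have hcomp : f = (f.comp (MvPolynomial.C.comp Polynomial.C)).comp
      ((Polynomial.evalRingHom α).comp (MvPolynomial.constantCoeff : PolyT K N →+* _)) := by
    refine MvPolynomial.ringHom_ext' (Polynomial.ringHom_ext' ?_ ?_) ?_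
    · ext a; simp
    · rw [map_sub, sub_eq_zero, T] at hT
      simpa using hT
    · intro l; simp [hX]
  ext a
  rw [RingHom.mem_ker, hcomp, RingHom.comp_apply, map_eq_zero_iff _ (RingHom.injective _),
    RingHom.mem_ker]

/-- The classes of the variables in the residue field of `Q` form a solution over α, hence vanish,
so `Q` is the origin of the fiber. -/
lemma comap_mk_eq_ker (n : ℕ) (j : Fin (n - 1) → Fin n) (α : K)
    (h : ∀ (L : Type u) [Field L] [Algebra K L] (x : Fin (n - 1) → L),
      IsSolution n j (algebraMap K L α) x → x = 0)
    (Q : Ideal (coordRing K n j)) [Q.IsPrime]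
    (hTQ : phi K n j (Polynomial.X - Polynomial.C α) ∈ Q) :
    Ideal.comap (Ideal.Quotient.mk (idealY K n j)) Q = RingHom.ker ((Polynomial.evalRingHom α).comp
      (MvPolynomial.constantCoeff : PolyT K (n - 1) →+* _)) := by
  let L := FractionRing (coordRing K n j ⧸ Q)
  let g : coordRing K n j →+* L :=
    (algebraMap (coordRing K n j ⧸ Q) L).comp (Ideal.Quotient.mk Q)
  have hg : RingHom.ker g = Q := by
    ext a
    rw [RingHom.mem_ker, RingHom.comp_apply, IsFractionRing.to_map_eq_zero_iff,
      Ideal.Quotient.eq_zero_iff_mem]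
  let f : PolyT K (n - 1) →+* L := g.comp (Ideal.Quotient.mk (idealY K n j))
  have hf : RingHom.ker f = Ideal.comap (Ideal.Quotient.mk (idealY K n j)) Q := by
    exact congrArg (Ideal.comap _) hg
  rw [← hf]
  let : Algebra K L := (f.comp (MvPolynomial.C.comp Polynomial.C)).toAlgebra
  have hT : f (T K (n - 1) - MvPolynomial.C (Polynomial.C α)) = 0 := by
    rw [← RingHom.mem_ker, hf, T, ← map_sub]
    exact hTQ
  refine ker_eq_of_map_X_eq_zero f (fun l => ?_) hT
  have hsol : IsSolution n j (algebraMap K L α) (fun i => f (MvPolynomial.X i)) := fun i => by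
    have hα : algebraMap K L α = f (T K (n - 1)) := by
      rw [map_sub, sub_eq_zero] at hT
      exact hT.symm
    rw [hα, ← map_elemSymm_shift, ← Phi_HD_prod_X]
    have hmem : Phi K n (j i) (HD K (n - 1) i (∏ l : Fin (n - 1), MvPolynomial.X l)) ∈
        idealY K n j := Ideal.subset_span ⟨i, rfl⟩
    exact (congrArg g (Ideal.Quotient.eq_zero_iff_mem.2 hmem)).trans (map_zero g)
  exact congrFun (h L _ hsol) l

lemma subsingleton_fiber (n : ℕ) (j : Fin (n - 1) → Fin n) (α : K)
    (h : ∀ (L : Type u) [Field L] [Algebra K L] (x : Fin (n - 1) → L),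
      IsSolution n j (algebraMap K L α) x → x = 0) : Subsingleton (fiber K n j α) := by
  have : IsClosedImmersion (point K α) :=
    IsClosedImmersion.spec_of_surjective _ Ideal.Quotient.mk_surjective
  let fst : fiber K n j α ⟶ Y K n j := pullback.fst _ _
  have : IsClosedImmersion fst := inferInstanceAs (IsClosedImmersion (pullback.fst _ _))
  suffices H : ∀ z : fiber K n j α, Ideal.comap (Ideal.Quotient.mk (idealY K n j))
      (fst z : PrimeSpectrum (coordRing K n j)).asIdeal = RingHom.ker ((Polynomial.evalRingHom α).comp
        (MvPolynomial.constantCoeff : PolyT K (n - 1) →+* _)) by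
    refine ⟨fun z w => fst.isClosedEmbedding.injective (PrimeSpectrum.ext ?_)⟩
    exact Ideal.comap_injective_of_surjective _ Ideal.Quotient.mk_surjective
      ((H z).trans (H w).symm)
  intro z
  set Q := (fst z : PrimeSpectrum (coordRing K n j))
  have hTQ : phi K n j (Polynomial.X - Polynomial.C α) ∈ Q.asIdeal := by
    let w : PrimeSpectrum (Polynomial K ⧸ Ideal.span {Polynomial.X - Polynomial.C α}) :=
      pullback.snd (phiStar K n j) (point K α) z
    have hcond : PrimeSpectrum.comap (phi K n j) Q =
        PrimeSpectrum.comap (Ideal.Quotient.mk _) w := by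
      have := congrArg (fun f : fiber K n j α ⟶ A1 K => f z)
        (pullback.condition (f := phiStar K n j) (g := point K α))
      exact this
    change Polynomial.X - Polynomial.C α ∈ (PrimeSpectrum.comap (phi K n j) Q).asIdeal
    rw [hcond, PrimeSpectrum.comap_asIdeal, Ideal.mem_comap,
      Ideal.Quotient.eq_zero_iff_mem.2 (Ideal.mem_span_singleton_self _)]
    exact zero_mem _
  have : Q.asIdeal.IsPrime := PrimeSpectrum.isPrime Q
  exact comap_mk_eq_ker n j α h Q.asIdeal hTQ

lemma not_isSingularFiber (n : ℕ) (j : Fin (n - 1) → Fin n) (α : K)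
    (h : ∀ (L : Type u) [Field L] [Algebra K L] (x : Fin (n - 1) → L),
      IsSolution n j (algebraMap K L α) x → x = 0) : ¬ IsSingularFiber K n j α := by
  have := subsingleton_fiber n j α h
  have : Subsingleton (TopologicalSpace.IrreducibleCloseds (fiber K n j α)) := by
    refine ⟨fun s t => TopologicalSpace.IrreducibleCloseds.ext ?_⟩
    rw [Set.Nonempty.eq_univ s.isIrreducible.nonempty, Set.Nonempty.eq_univ t.isIrreducible.nonempty]
  exact not_lt.2 Order.krullDim_nonpos_of_subsingleton

end Fiber

end CasasAlvero

theorem theorem4p11 {K : Type*} [Field K] [IsAlgClosed K] [CharZero K]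
    (n : ℕ) (hn : 2 ≤ n) (j : Fin (n - 1) → Fin n) :
    (∀ q : ℚ, (¬ ∃ m : ℤ, m ≠ 0 ∧ q = 1 / (m : ℚ)) →
      ¬ CasasAlvero.IsSingularFiber K n j (q : K)) ∧
    (∀ m : ℤ, 2 ≤ |m| →
      ∃ P : Finset ℕ, (∀ p ∈ P, p.Prime) ∧
        ∀ p : ℕ, p.Prime → p ∉ P →
          ¬ CasasAlvero.IsSingularFiber K n j (((1 / (m : ℚ) ^ (p - 2) : ℚ)) : K)) := by
  refine ⟨fun q hq => CasasAlvero.not_isSingularFiber n j _ fun L _ _ x hx => ?_, fun m hm => ?_⟩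
  · have : CharZero L := charZero_of_injective_algebraMap (algebraMap K L).injective
    rw [map_ratCast] at hx
    -- If the numerator is ±1, it is its own inverse, so q = 1 / (num * den).
    refine hx.eq_zero_of_rat fun hnum => hq ⟨q.num * q.den, ?_, ?_⟩
    · simp [← Int.natAbs_eq_zero, hnum]
    · have hsq : (q.num : ℚ) * q.num = 1 := by
        have := Int.natAbs_mul_self' q.num
        rw [hnum] at this
        exact_mod_cast this.symm
      have hd : (q.den : ℚ) ≠ 0 := by simp
      have hn0 : (q.num : ℚ) ≠ 0 := fun h => by simp [h] at hsq
      nth_rewrite 1 [← q.num_div_den]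
      push_cast
      field_simp
      linear_combination hsq
  · obtain ⟨P, hP, h⟩ := CasasAlvero.exists_finset_primes_forall_eq_zero n j hm
    refine ⟨P, hP, fun p hp hpP => CasasAlvero.not_isSingularFiber n j _ fun L _ _ x hx => ?_⟩
    have : CharZero L := charZero_of_injective_algebraMap (algebraMap K L).injective
    rw [map_ratCast] at hx
    exact h p hp hpP x hx
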